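/- Let $n\ge 1$ and let $\varepsilon_{ij}=\varepsilon_{ji}\in\mathbb R$ ($i\neq j$) be the edge weights of an instance of the symmetric travelling salesman problem on the complete graph with nodes $1,\dots,n$. Suppose the weights of the $n(n-1)/2$ undirected edges are rationally independent, i.e. no nontrivial integer combination of them vanishes (in particular they are pairwise distinct). For $\alpha\in\{0,\pi\}^n$ and $\beta,\gamma\in\mathbb R$ let the depth-one equivariant quantum circuit (EQC) prepare the $n$-qubit state $$|\varepsilon,\alpha,\beta,\gamma\rangle_1=\Big(\bigotimes_{l=1}^n e^{-i\frac{\alpha_l\beta}{2}X}\Big)\,\exp\Big(-i\gamma\sum_{i<j}\varepsilon_{ij}Z_iZ_j\Big)\,\frac1{\sqrt{2^n}}\sum_{x\in\{0,1\}^n}|x\rangle ,$$ where $X,Z$ are the Pauli matrices and $Z_i$ acts on qubit $i$. The node-selection process with parameters $(\beta,\gamma)$ and start node $v_0$ builds a tour as follows. The tour starts at $v_0$. Given the partial tour, with last node $u$, put $\alpha_i=0$ for the nodes $i$ in the partial tour and $\alpha_i=\pi$ for the other (available) nodes, and add next an available node $v$ that maximizes $$Q(v)=\langle\varepsilon,\alpha,\beta,\gamma|_1\;\varepsilon_{uv}Z_uZ_v\;|\varepsilon,\alpha,\beta,\gamma\rangle_1$$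 among all available nodes. After $n-2$ such steps the last remaining node is appended. The length of a tour $(v_0,\dots,v_{n-1})$ is the sum of the weights of its edges, including the edge from $v_{n-1}$ back to $v_0$; a tour is optimal if no tour is shorter. Then for every node $v_0$ and every optimal tour $T^*$, written as a sequence of nodes starting at $v_0$, there are $\beta,\gamma\in\mathbb R$ such that $\varepsilon_{ij}\gamma\neq\frac{\pi}{4}+m\pi$ for all $i\neq j$ and all $m\in\mathbb Z$, and such that the node-selection process with parameters $(\beta,\gamma)$ and start node $v_0$ produces $T^*$, and only $T^*$, however ties are broken. -/

import Mathlib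

open scoped Matrix

noncomputable section

namespace EQC

/-- Labels of the computational basis of `n` qubits: bit strings of length `n`. -/
abbrev Bits (n : ℕ) : Type := Fin n → Fin 2

/-- The Pauli matrix `X`. -/
def pauliX : Matrix (Fin 2) (Fin 2) ℂ := !![0, 1; 1, 0]

/-- The Pauli matrix `Z`. -/
def pauliZ : Matrix (Fin 2) (Fin 2) ℂ := !![1, 0; 0, -1]

/-- The tensor (Kronecker) product `A₁ ⊗ ⋯ ⊗ Aₙ` of one-qubit operators. -/
def tensor {n : ℕ} (A : Fin n → Matrix (Fin 2) (Fin 2) ℂ) : Matrix (Bits n) (Bits n) ℂ :=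
  Matrix.of fun x y => ∏ l, A l (x l) (y l)

/-- `Z_i`: the Pauli matrix `Z` on qubit `i`, the identity on all other qubits. -/
def Zop {n : ℕ} (i : Fin n) : Matrix (Bits n) (Bits n) ℂ :=
  tensor (Function.update (fun _ => 1) i pauliZ)

/-- The uniform superposition `|s⟩ = 2^{-n/2} ∑ₓ |x⟩`. -/
def uniformState (n : ℕ) : Bits n → ℂ := fun _ => ((1 / Real.sqrt (2 ^ n) : ℝ) : ℂ)

/-- The rotation `Rx(θ) = exp(-i (θ/2) X)`. -/
def Rx (θ : ℝ) : Matrix (Fin 2) (Fin 2) ℂ :=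
  NormedSpace.exp ((-(Complex.I * ((θ / 2 : ℝ) : ℂ))) • pauliX)

/-- The node layer `U_N(α, β) = ⨂ₗ Rx(αₗ β)`. -/
def nodeLayer {n : ℕ} (α : Fin n → ℝ) (β : ℝ) : Matrix (Bits n) (Bits n) ℂ :=
  tensor fun l => Rx (α l * β)

/-- The edges of the complete graph on `n` nodes, each undirected edge listed once, as the
pair `(i, j)` with `i < j`. -/
abbrev Edge (n : ℕ) : Type := {e : Fin n × Fin n // e.1 < e.2}

/-- The graph Hamiltonian `H_G = ∑_{edges} ε_{ij} Z_i Z_j`. -/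
def graphHamiltonian {n : ℕ} (ε : Fin n → Fin n → ℝ) : Matrix (Bits n) (Bits n) ℂ :=
  ∑ e : Edge n, ((ε e.1.1 e.1.2 : ℝ) : ℂ) • (Zop e.1.1 * Zop e.1.2)

/-- The edge layer `U_G(ε, γ) = exp(-i γ H_G)`. -/
def edgeLayer {n : ℕ} (ε : Fin n → Fin n → ℝ) (γ : ℝ) : Matrix (Bits n) (Bits n) ℂ :=
  NormedSpace.exp ((-(Complex.I * (γ : ℂ))) • graphHamiltonian ε)

/-- The state of the equivariant quantum circuit at depth one,
`U_N(α, β) U_G(ε, γ) |s⟩`. -/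
def circuitState {n : ℕ} (ε : Fin n → Fin n → ℝ) (α : Fin n → ℝ) (β γ : ℝ) : Bits n → ℂ :=
  nodeLayer α β *ᵥ (edgeLayer ε γ *ᵥ uniformState n)

/-- The annotation of the nodes: `0` for nodes already in the partial tour, `π` for nodes that
are still available. -/
def annotation {n : ℕ} (visited : Finset (Fin n)) : Fin n → ℝ :=
  fun i => if i ∈ visited then 0 else Real.pi

/-- The observable `O_v = ε_{u v} Z_u Z_v` of the candidate `v`, where `u` is the last node of
the partial tour. -/
def observable {n : ℕ} (ε : Fin n → Fin n → ℝ) (u v : Fin n) : Matrix (Bits n) (Bits n) ℂ :=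
  ((ε u v : ℝ) : ℂ) • (Zop u * Zop v)

/-- The Q-value `⟨ψ| O_v |ψ⟩` of the candidate `v`, where `ψ` is the depth-one circuit state of
the annotated graph. As `O_v` is Hermitian, taking the real part loses nothing. -/
def qValue {n : ℕ} (ε : Fin n → Fin n → ℝ) (β γ : ℝ) (visited : Finset (Fin n))
    (u v : Fin n) : ℝ :=
  (star (circuitState ε (annotation visited) β γ) ⬝ᵥ
    (observable ε u v *ᵥ circuitState ε (annotation visited) β γ)).re

/-- `v` is a permitted choice of the next node after the last node `u`: it is available, and its
Q-value is maximal among the available nodes. -/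
def IsNextNode {n : ℕ} (ε : Fin n → Fin n → ℝ) (β γ : ℝ) (visited : Finset (Fin n))
    (u v : Fin n) : Prop :=
  v ∉ visited ∧ ∀ w, w ∉ visited → qValue ε β γ visited u w ≤ qValue ε β γ visited u v

/-- A tour, as the sequence `T 0, T 1, …, T (n-1)` of its nodes (each node once); from the last
node it returns to the first. -/
abbrev Tour (n : ℕ) : Type := Equiv.Perm (Fin n)

/-- The nodes that are in the partial tour before position `t` is filled. -/
def visitedBefore {n : ℕ} (T : Tour n) (t : Fin n) : Finset (Fin n) :=
  (Finset.univ.filter fun s => s < t).image T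

/-- `T` is a possible outcome of the node selection process with parameters `β, γ` and start
node `v₀`: the tour starts at `v₀`, and in each of the `n - 2` steps (which fill the positions
`1, …, n - 2`) the next node has maximal Q-value among the available ones, ties being broken in
any way. The last remaining node is then appended. -/
def Produces {n : ℕ} [NeZero n] (ε : Fin n → Fin n → ℝ) (β γ : ℝ) (v₀ : Fin n)
    (T : Tour n) : Prop :=
  T 0 = v₀ ∧ ∀ s t : Fin n, (s : ℕ) + 1 = t → (t : ℕ) + 1 < n →
    IsNextNode ε β γ (visitedBefore T t) (T s) (T t)

/-- The length `c(T)` of a tour, including the edge from its last node back to its first. -/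
def tourLength {n : ℕ} (ε : Fin n → Fin n → ℝ) (T : Tour n) : ℝ :=
  ∑ t : Fin n, ε (T t) (T (finRotate n t))

/-- `T` is an optimal tour: no tour is shorter. -/
def IsOptimalTour {n : ℕ} (ε : Fin n → Fin n → ℝ) (T : Tour n) : Prop :=
  ∀ T' : Tour n, tourLength ε T ≤ tourLength ε T'

/-- The edge weights are rationally independent: no non-trivial integer combination of the
weights of the (undirected) edges vanishes. -/
def RationallyIndependent {n : ℕ} (ε : Fin n → Fin n → ℝ) : Prop :=
  LinearIndependent ℤ fun e : Edge n => ε e.1.1 e.1.2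

end EQC

end

/-! Take `β = 1 / 2`: available nodes are rotated by `π / 2`, visited ones not at all. In the
Heisenberg picture `Z_u Z_v` becomes `Z_u Y_v`, which flips only qubit `v`. The phases picked up by
that flip factor over the edges at `v`, so the Q-value is `ε_uv sin(2 ε_uv γ)` times the product of
`cos(2 ε_vk γ)` over `k ≠ u, v` (`EQC.qValue_eq`).

By rational independence, Kronecker's theorem (`LinearIndependent.exists_norm_exp_sub_one_lt`)
yields one `γ` for which the angles `2 ε_e γ` are, modulo `2π`, close to `±π / 4` (with the sign of
`ε_e`) on the edges of the path `T`, and close to `0` on all others. Every cosine is then at least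
`1 / 2`, while `ε_e sin(2 ε_e γ)` is bounded below on path edges and negligible elsewhere. At each
step exactly one available node is joined to the last node by a path edge, namely the successor in
`T`, and it wins strictly.

Kronecker's theorem is proved by comparing the coefficients of `∏ (1 + z_i) ^ N` with its supremum
along the flow. -/

/-! ### Kronecker's theorem on the torus. -/

open Complex in
/-- Each coefficient of a trigonometric polynomial with distinct frequencies is bounded by the
supremum of the polynomial. -/
theorem norm_coeff_le_of_norm_trigPolynomial_le {κ : Type*} [DecidableEq κ] {s : Finset κ}
    {c : κ → ℂ} {μ : κ → ℝ} (hμ : Set.InjOn μ s) {M : ℝ}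
    (hM : ∀ t : ℝ, ‖∑ k ∈ s, c k * exp (I * μ k * t)‖ ≤ M) {a : κ} (ha : a ∈ s) :
    ‖c a‖ ≤ M := by
  -- Multiply by `exp(-i μ_a t)` and integrate over `[0, T]`: frequency `a` contributes `T * c a`,
  -- the others at most `K`, independently of `T`.
  set K : ℝ := ∑ k ∈ s.erase a, ‖c k‖ * (2 / |μ k - μ a|) with hK
  have key : ∀ T : ℝ, 0 < T → T * ‖c a‖ ≤ M * T + K := by
    intro T hT
    have hint : ∀ k ∈ s, IntervalIntegrable
        (fun t : ℝ => c k * exp (I * (μ k - μ a) * t)) MeasureTheory.volume 0 T := fun k _ =>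
      Continuous.intervalIntegrable (by fun_prop) _ _
    have h1 : ∫ t in (0 : ℝ)..T, ∑ k ∈ s, c k * exp (I * (μ k - μ a) * t)
        = T * c a + ∑ k ∈ s.erase a, c k * ∫ t in (0 : ℝ)..T, exp (I * (μ k - μ a) * t) := by
      rw [intervalIntegral.integral_finsetSum hint, ← Finset.add_sum_erase _ _ ha]
      simp
    have h2 : ‖∫ t in (0 : ℝ)..T, ∑ k ∈ s, c k * exp (I * (μ k - μ a) * t)‖ ≤ M * T := by
      have := intervalIntegral.norm_integral_le_of_norm_le_const (a := (0 : ℝ)) (b := T) (C := M)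
        (f := fun t : ℝ => ∑ k ∈ s, c k * exp (I * (μ k - μ a) * t)) (fun t _ => by
          have h3 : ∑ k ∈ s, c k * exp (I * (μ k - μ a) * t)
              = exp ((-(μ a * t) : ℝ) * I) * ∑ k ∈ s, c k * exp (I * μ k * t) := by
            rw [Finset.mul_sum]
            refine Finset.sum_congr rfl fun k _ => ?_
            rw [mul_left_comm, ← Complex.exp_add]
            congr 2
            push_cast
            ring
          rw [h3, norm_mul, norm_exp_ofReal_mul_I, one_mul]
          exact hM t)
      simpa [abs_of_pos hT] using this
    have h4 : ‖∑ k ∈ s.erase a, c k * ∫ t in (0 : ℝ)..T, exp (I * (μ k - μ a) * t)‖ ≤ K := by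
      refine norm_sum_le_of_le _ fun k hk => ?_
      rw [norm_mul]
      gcongr
      have hne : μ k - μ a ≠ 0 := fun h =>
        (Finset.mem_erase.1 hk).1 (hμ (Finset.mem_erase.1 hk).2 ha (sub_eq_zero.1 h))
      have hne' : (I * ((μ k : ℂ) - μ a)) ≠ 0 :=
        mul_ne_zero I_ne_zero (by exact_mod_cast hne)
      rw [integral_exp_mul_complex hne', norm_div]
      have hd : ‖I * ((μ k : ℂ) - μ a)‖ = |μ k - μ a| := by
        rw [norm_mul, norm_I, one_mul, ← Complex.ofReal_sub, Complex.norm_real, Real.norm_eq_abs]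
      rw [hd]
      gcongr
      refine (norm_sub_le _ _).trans ?_
      have he : ∀ x : ℝ, ‖exp (I * ((μ k : ℂ) - μ a) * x)‖ = 1 := fun x => by
        have : I * ((μ k : ℂ) - μ a) * x = (((μ k - μ a) * x : ℝ) : ℂ) * I := by
          push_cast; ring
        rw [this, norm_exp_ofReal_mul_I]
      rw [he, he]
      norm_num
    have h5 : ‖(T : ℂ) * c a‖ = T * ‖c a‖ := by
      rw [norm_mul, Complex.norm_real, Real.norm_eq_abs, abs_of_pos hT]
    rw [← h5, ← add_sub_cancel_right ((T : ℂ) * c a), ← h1]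
    exact (norm_sub_le _ _).trans (add_le_add h2 h4)
  by_contra! hlt
  have hK0 : 0 ≤ K := Finset.sum_nonneg fun k _ => by positivity
  have hpos : 0 < ‖c a‖ - M := sub_pos.2 hlt
  -- For this `T`, `key` would give `K + 1 ≤ K`.
  have := key ((K + 1) / (‖c a‖ - M)) (by positivity)
  have h6 : (K + 1) / (‖c a‖ - M) * (‖c a‖ - M) = K + 1 := div_mul_cancel₀ _ hpos.ne'
  nlinarith

/-- Guarantees that no two monomials in the expansion of `∏ (1 + z_i) ^ N` share a frequency. -/
theorem LinearIndependent.injective_sum_natCast_mul {ι : Type*} [Fintype ι] {ε : ι → ℝ}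
    (h : LinearIndependent ℤ ε) :
    Function.Injective fun p : ι → ℕ => ∑ i, (p i : ℝ) * ε i := by
  intro p q hpq
  have h0 := Fintype.linearIndependent_iff.1 h (fun i => (p i : ℤ) - q i) (by
    simp only [zsmul_eq_mul, Int.cast_sub, Int.cast_natCast, sub_mul, Finset.sum_sub_distrib]
    exact sub_eq_zero.2 hpq)
  ext i
  have := h0 i
  omega

theorem norm_one_add_sq_of_norm_eq_one {z : ℂ} (hz : ‖z‖ = 1) :
    ‖1 + z‖ ^ 2 = 4 - ‖z - 1‖ ^ 2 := by
  have h := parallelogram_law_with_norm ℝ z 1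
  rw [add_comm 1 z]
  rw [hz] at h
  norm_num at h
  linarith

open Complex in
/-- **Kronecker's theorem** for a one-parameter flow on a torus: if the frequencies are linearly
independent over `ℤ`, the flow comes arbitrarily close to any prescribed point. -/
theorem LinearIndependent.exists_norm_exp_sub_one_lt {ι : Type*} [Fintype ι] {ε : ι → ℝ}
    (h : LinearIndependent ℤ ε) (φ : ι → ℝ) {δ : ℝ} (hδ : 0 < δ) :
    ∃ t : ℝ, ∀ i, ‖exp (((ε i * t - φ i : ℝ) : ℂ) * I) - 1‖ < δ := by
  classical
  by_contra! hcon
  set z : ι → ℝ → ℂ := fun i t => exp (((ε i * t - φ i : ℝ) : ℂ) * I) with hz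
  have hz1 : ∀ i t, ‖z i t‖ = 1 := fun i t => norm_exp_ofReal_mul_I _
  have hle2 : ∀ i t, ‖1 + z i t‖ ≤ 2 := fun i t =>
    (norm_add_le _ _).trans (by rw [hz1, norm_one]; norm_num)
  -- If some `z_i` stays `δ` away from `1`, the parallelogram law gives `‖1 + z_i‖ ≤ r < 2`, so the
  -- product loses a factor `r / 2` against its maximum `2 ^ d`.
  set r : ℝ := Real.sqrt (4 - δ ^ 2) with hr
  have hr0 : 0 ≤ r := Real.sqrt_nonneg _
  have hr2 : r < 2 := by
    rw [hr, Real.sqrt_lt' (by norm_num)]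
    nlinarith
  set d := Fintype.card ι with hd
  have hprod : ∀ t, ∏ i, ‖1 + z i t‖ ≤ r / 2 * 2 ^ d := by
    intro t
    obtain ⟨i, hi⟩ := hcon t
    have hir : ‖1 + z i t‖ ≤ r := by
      apply Real.le_sqrt_of_sq_le
      rw [norm_one_add_sq_of_norm_eq_one (hz1 i t)]
      have := pow_le_pow_left₀ hδ.le hi 2
      linarith
    have hrest : ∏ j ∈ Finset.univ.erase i, ‖1 + z j t‖ ≤ 2 ^ (d - 1) := by
      refine (Finset.prod_le_prod (fun _ _ => norm_nonneg _) fun j _ => hle2 j t).trans ?_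
      simp [hd]
    have hd1 : d = d - 1 + 1 := by
      have : 0 < d := Fintype.card_pos_iff.2 ⟨i⟩
      omega
    rw [← Finset.mul_prod_erase _ _ (Finset.mem_univ i)]
    calc _ ≤ r * 2 ^ (d - 1) :=
          mul_le_mul hir hrest (Finset.prod_nonneg fun _ _ => norm_nonneg _) hr0
      _ = r / 2 * 2 ^ d := by conv_rhs => rw [hd1, pow_succ]
                              ring
  -- The `N`-th power of the product has `(N + 1) ^ d` coefficients, whose moduli are products of
  -- binomials with sum `(2 ^ d) ^ N`. Each is at most the supremum, hence at most `(r / 2 * 2 ^ d)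
  -- ^ N`. Exponential decay beats the polynomial count, a contradiction for large `N`.
  have hbound : ∀ N : ℕ, 1 ≤ ((N : ℝ) + 1) ^ d * (r / 2) ^ N := by
    intro N
    set s := Fintype.piFinset fun _ : ι => Finset.range (N + 1) with hs
    set c : (ι → ℕ) → ℂ := fun p =>
      ∏ i, (exp (((-(p i * φ i) : ℝ) : ℂ) * I) * (N.choose (p i) : ℂ)) with hc
    have hcn : ∀ p, ‖c p‖ = ∏ i, (N.choose (p i) : ℝ) := fun p => by
      simp only [hc, norm_prod, norm_mul, norm_exp_ofReal_mul_I, one_mul, Complex.norm_natCast]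
    have hexpand : ∀ t : ℝ, ∏ i, (1 + z i t) ^ N
        = ∑ p ∈ s, c p * exp (I * (∑ i, (p i : ℝ) * ε i : ℝ) * t) := by
      intro t
      have h1 : ∀ i, (1 + z i t) ^ N
          = ∑ m ∈ Finset.range (N + 1), z i t ^ m * (N.choose m : ℂ) := fun i => by
        rw [add_comm, add_pow]
        simp
      simp_rw [h1]
      rw [Finset.prod_univ_sum]
      refine Finset.sum_congr rfl fun p _ => ?_
      have h2 : exp (I * (∑ i, (p i : ℝ) * ε i : ℝ) * t) = ∏ i, exp (I * (p i * ε i) * t) := by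
        rw [← Complex.exp_sum]
        push_cast
        rw [Finset.mul_sum, Finset.sum_mul]
      rw [h2, hc, ← Finset.prod_mul_distrib]
      refine Finset.prod_congr rfl fun i _ => ?_
      rw [mul_right_comm, ← Complex.exp_add, hz, ← Complex.exp_nat_mul]
      congr 2
      push_cast
      ring
    have hM : ∀ t : ℝ, ‖∑ p ∈ s, c p * exp (I * (∑ i, (p i : ℝ) * ε i : ℝ) * t)‖
        ≤ (r / 2 * 2 ^ d) ^ N := by
      intro t
      rw [← hexpand, Finset.prod_pow, norm_pow, norm_prod]
      exact pow_le_pow_left₀ (Finset.prod_nonneg fun _ _ => norm_nonneg _) (hprod t) N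
    have hcoef : ∀ p ∈ s, ‖c p‖ ≤ (r / 2 * 2 ^ d) ^ N := fun p hp =>
      norm_coeff_le_of_norm_trigPolynomial_le (h.injective_sum_natCast_mul.injOn) hM hp
    have hsum : ∑ p ∈ s, ‖c p‖ = (2 ^ d) ^ N := by
      simp_rw [hcn, hs]
      rw [← Finset.prod_univ_sum (fun _ : ι => Finset.range (N + 1))
        (fun _ m => (N.choose m : ℝ))]
      have h3 : ∑ m ∈ Finset.range (N + 1), (N.choose m : ℝ) = 2 ^ N := by
        exact_mod_cast Nat.sum_range_choose N
      rw [h3, Finset.prod_const, Finset.card_univ, ← hd, ← pow_mul, ← pow_mul, mul_comm]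
    have hcard : (s.card : ℝ) = ((N : ℝ) + 1) ^ d := by
      simp [hs, hd]
    have h4 : (2 ^ d : ℝ) ^ N ≤ ((N : ℝ) + 1) ^ d * (r / 2 * 2 ^ d) ^ N := by
      rw [← hsum, ← hcard, ← nsmul_eq_mul]
      exact Finset.sum_le_card_nsmul _ _ _ hcoef
    rw [mul_pow, ← mul_assoc] at h4
    have h5 : (0 : ℝ) < (2 ^ d) ^ N := by positivity
    exact le_of_mul_le_mul_right (by linarith) h5
  have hlim : Filter.Tendsto (fun N : ℕ => 2 ^ d * ((N : ℝ) ^ d * (r / 2) ^ N)) Filter.atTop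
      (nhds (2 ^ d * 0)) :=
    (tendsto_pow_const_mul_const_pow_of_abs_lt_one d
      (by rw [abs_of_nonneg (by positivity)]; linarith)).const_mul _
  rw [mul_zero] at hlim
  obtain ⟨N, hN, hN1⟩ :=
    ((hlim.eventually (gt_mem_nhds one_pos)).and (Filter.eventually_ge_atTop 1)).exists
  have h6 : ((N : ℝ) + 1) ^ d ≤ 2 ^ d * (N : ℝ) ^ d := by
    rw [← mul_pow]
    have : (1 : ℝ) ≤ N := by exact_mod_cast hN1
    exact pow_le_pow_left₀ (by positivity) (by linarith) d
  have h7 : ((N : ℝ) + 1) ^ d * (r / 2) ^ N ≤ 2 ^ d * (N : ℝ) ^ d * (r / 2) ^ N :=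
    mul_le_mul_of_nonneg_right h6 (by positivity)
  linarith [hbound N, mul_assoc ((2 : ℝ) ^ d) ((N : ℝ) ^ d) ((r / 2) ^ N)]

/-! ### One-qubit operators and their tensor products. -/

namespace EQC

/-- The eigenvalue of `Z` on a computational basis state. -/
def spin (a : Fin 2) : ℝ := if a = 0 then 1 else -1

theorem spin_zero : spin 0 = 1 := rfl

theorem spin_one : spin 1 = -1 := rfl

theorem spin_one_sub (a : Fin 2) : spin (1 - a) = -spin a := by
  fin_cases a <;> simp [spin]

theorem pauliZ_eq_diagonal : pauliZ = Matrix.diagonal fun a => (spin a : ℂ) := by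
  ext a b
  fin_cases a <;> fin_cases b <;> simp [pauliZ, spin]

theorem tensor_mul_tensor {n : ℕ} (A B : Fin n → Matrix (Fin 2) (Fin 2) ℂ) :
    tensor A * tensor B = tensor fun l => A l * B l := by
  ext x y
  simp only [tensor, Matrix.mul_apply, Matrix.of_apply, ← Finset.prod_mul_distrib]
  rw [Finset.prod_univ_sum, Fintype.piFinset_univ]

theorem conjTranspose_tensor {n : ℕ} (A : Fin n → Matrix (Fin 2) (Fin 2) ℂ) :
    (tensor A)ᴴ = tensor fun l => (A l)ᴴ := by
  ext x y
  simp [tensor]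

theorem Zop_eq_diagonal {n : ℕ} (i : Fin n) :
    Zop i = Matrix.diagonal fun x : Bits n => (spin (x i) : ℂ) := by
  ext x y
  simp only [Zop, tensor, Matrix.of_apply, Matrix.diagonal_apply]
  split_ifs with h
  · subst h
    rw [Finset.prod_eq_single i]
    · simp [pauliZ_eq_diagonal]
    · intro j _ hj
      simp [hj]
    · simp
  · obtain ⟨j, hj⟩ := Function.ne_iff.1 h
    refine Finset.prod_eq_zero (Finset.mem_univ j) ?_
    rcases eq_or_ne j i with rfl | hji
    · simp [pauliZ_eq_diagonal, hj]
    · simp [hji, hj]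

theorem Zop_mul_Zop {n : ℕ} {u v : Fin n} (huv : u ≠ v) :
    Zop u * Zop v = tensor fun l => if l = u ∨ l = v then pauliZ else 1 := by
  rw [Zop, Zop, tensor_mul_tensor]
  congr 1
  ext1 l
  rcases eq_or_ne l u with rfl | hu
  · simp [huv]
  · rcases eq_or_ne l v with rfl | hv
    · simp [hu]
    · simp [hu, hv]

/-- The unnormalised Hadamard matrix `H` diagonalises `X`, which reduces the matrix exponential to
scalar ones. -/
theorem Rx_eq (θ : ℝ) :
    Rx θ = !![Complex.cos (θ / 2), -(Complex.I * Complex.sin (θ / 2));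
      -(Complex.I * Complex.sin (θ / 2)), Complex.cos (θ / 2)] := by
  set H : Matrix (Fin 2) (Fin 2) ℂ := !![1, 1; 1, -1] with hH
  have hHH : H * ((1 / 2 : ℂ) • H) = 1 := by
    ext a b
    fin_cases a <;> fin_cases b <;> simp [hH] <;> norm_num
  have hinv : H⁻¹ = (1 / 2 : ℂ) • H := Matrix.inv_eq_right_inv hHH
  have hunit : IsUnit H := IsUnit.of_mul_eq_one _ hHH
  have hdiag : ∀ p q : ℂ, Matrix.diagonal ![p, q] = !![p, 0; 0, q] := fun p q => by
    ext i j
    fin_cases i <;> fin_cases j <;> simp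
  set a : ℂ := -(Complex.I * ((θ / 2 : ℝ) : ℂ)) with ha
  have hX : a • pauliX = H * Matrix.diagonal ![a, -a] * H⁻¹ := by
    rw [hinv, hdiag]
    ext i j
    fin_cases i <;> fin_cases j <;> simp [hH, pauliX, Matrix.mul_apply, Fin.sum_univ_two] <;> ring
  have hexp : NormedSpace.exp ![a, -a] = ![Complex.exp a, Complex.exp (-a)] := by
    ext i
    rw [Pi.coe_exp, ← Complex.exp_eq_exp_ℂ]
    fin_cases i <;> rfl
  have e1 : a = -((θ / 2 : ℂ)) * Complex.I := by rw [ha]; push_cast; ring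
  have e2 : -a = (θ / 2 : ℂ) * Complex.I := by rw [e1]; ring
  rw [Rx, ← ha, hX, Matrix.exp_conj _ _ hunit, Matrix.exp_diagonal, hexp, hdiag, hinv, e2, e1]
  ext i j
  rw [Complex.cos, Complex.sin]
  have hI : Complex.I ^ 2 = -1 := Complex.I_sq
  fin_cases i <;> fin_cases j <;> simp [hH, Matrix.mul_apply, Fin.sum_univ_two] <;> ring_nf <;>
    simp [hI] <;> ring

theorem conjTranspose_Rx_mul_self (θ : ℝ) : (Rx θ)ᴴ * Rx θ = 1 := by
  have h := Complex.sin_sq_add_cos_sq (θ / 2 : ℂ)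
  have hc : (starRingEnd ℂ) (Complex.cos (θ / 2)) = Complex.cos (θ / 2) := by
    rw [← Complex.cos_conj]; simp [map_ofNat]
  have hs : (starRingEnd ℂ) (Complex.sin (θ / 2)) = Complex.sin (θ / 2) := by
    rw [← Complex.sin_conj]; simp [map_ofNat]
  have hI : Complex.I ^ 2 = -1 := Complex.I_sq
  rw [Rx_eq]
  ext i j
  fin_cases i <;> fin_cases j <;> simp [Matrix.mul_apply, Fin.sum_univ_two, hc, hs] <;>
    first | ring1 | linear_combination h - Complex.sin (θ / 2) ^ 2 * hI

theorem Rx_zero : Rx 0 = 1 := by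
  rw [Rx_eq, Matrix.one_fin_two]
  simp

/-- A quarter turn about the `X` axis carries `Z` to the Pauli matrix `Y`, with no `Z` component
left; this is the reason for `β = 1 / 2`. -/
theorem conjTranspose_Rx_mul_pauliZ_mul_Rx_pi_div_two :
    (Rx (Real.pi * (1 / 2)))ᴴ * pauliZ * Rx (Real.pi * (1 / 2)) =
      !![0, -Complex.I; Complex.I, 0] := by
  have e : ((Real.pi * (1 / 2) : ℝ) : ℂ) / 2 = ((Real.pi / 4 : ℝ) : ℂ) := by push_cast; ring
  have h2 : ((Real.sqrt 2 : ℝ) : ℂ) ^ 2 = 2 := by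
    rw [← Complex.ofReal_pow, Real.sq_sqrt (by norm_num)]; norm_num
  rw [Rx_eq, e, ← Complex.ofReal_cos, ← Complex.ofReal_sin, Real.cos_pi_div_four,
    Real.sin_pi_div_four]
  ext i j
  fin_cases i <;> fin_cases j <;>
    simp [Matrix.mul_apply, Fin.sum_univ_two, pauliZ, Complex.conj_ofReal] <;> ring_nf <;>
    simp [h2, map_ofNat]

end EQC

/-! ### Closed form of the Q-value at `β = 1 / 2`. -/

namespace EQC

/-- The eigenvalue of the graph Hamiltonian on a computational basis state. -/
def energy {n : ℕ} (ε : Fin n → Fin n → ℝ) (x : Bits n) : ℝ :=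
  ∑ e : Edge n, ε e.1.1 e.1.2 * (spin (x e.1.1) * spin (x e.1.2))

theorem graphHamiltonian_eq_diagonal {n : ℕ} (ε : Fin n → Fin n → ℝ) :
    graphHamiltonian ε = Matrix.diagonal fun x => (energy ε x : ℂ) := by
  ext x y
  simp only [graphHamiltonian, Zop_eq_diagonal, Matrix.diagonal_mul_diagonal, Matrix.sum_apply,
    Matrix.smul_apply, Matrix.diagonal_apply, energy]
  split_ifs <;> simp

theorem edgeLayer_mulVec_uniformState {n : ℕ} (ε : Fin n → Fin n → ℝ) (γ : ℝ) (x : Bits n) :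
    (edgeLayer ε γ *ᵥ uniformState n) x
      = Complex.exp (((-(γ * energy ε x) : ℝ) : ℂ) * Complex.I)
        * ((1 / Real.sqrt (2 ^ n) : ℝ) : ℂ) := by
  rw [edgeLayer, graphHamiltonian_eq_diagonal, ← Matrix.diagonal_smul, Matrix.exp_diagonal,
    Matrix.mulVec_diagonal, Pi.coe_exp, ← Complex.exp_eq_exp_ℂ, uniformState]
  congr 2
  simp only [Pi.smul_apply, smul_eq_mul]
  push_cast
  ring

/-- Removes the orientation `i < j`, so that the edges at a given node can be collected without case
distinctions. -/
theorem sum_edge_eq_half_sum {n : ℕ} (f : Fin n → Fin n → ℝ) (hf : ∀ i j, f i j = f j i) :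
    2 * ∑ e : Edge n, f e.1.1 e.1.2 = ∑ i, ∑ j, if i = j then 0 else f i j := by
  have h1 : ∑ e : Edge n, f e.1.1 e.1.2
      = ∑ i, ∑ j, if i < j then f i j else 0 := by
    rw [← Fintype.sum_prod_type' (f := fun i j => if i < j then f i j else 0),
      ← Finset.sum_filter]
    exact (Finset.sum_subtype (p := fun e : Fin n × Fin n => e.1 < e.2) _ (by simp)
      (fun e => f e.1 e.2)).symm
  have h2 : ∑ i, ∑ j, (if i < j then f i j else 0) = ∑ i, ∑ j, if j < i then f i j else 0 := by
    rw [Finset.sum_comm]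
    simp only [hf]
  rw [h1, two_mul]
  nth_rewrite 2 [h2]
  simp only [← Finset.sum_add_distrib]
  refine Finset.sum_congr rfl fun i _ => Finset.sum_congr rfl fun j _ => ?_
  rcases lt_trichotomy i j with h | h | h
  · simp [h, h.ne, h.not_gt]
  · simp [h]
  · simp [h, h.ne', h.not_gt]

/-- Flipping one spin changes the energy by twice the contribution of its edges. -/
theorem energy_sub_energy_flip {n : ℕ} {ε : Fin n → Fin n → ℝ} (hsymm : ∀ i j, ε i j = ε j i)
    (x : Bits n) (v : Fin n) :
    energy ε x - energy ε (Function.update x v (1 - x v))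
      = ∑ k ∈ Finset.univ.erase v, 2 * ε v k * (spin (x v) * spin (x k)) := by
  set y := Function.update x v (1 - x v) with hy
  have hyv : spin (y v) = -spin (x v) := by simp [hy, spin_one_sub]
  have hyk : ∀ k, k ≠ v → y k = x k := fun k hk => by simp [hy, hk]
  -- The change in each edge term: it vanishes off `v`, and the symmetric double sum meets each edge
  -- at `v` twice, once in row `v` and once in column `v`.
  set f : Fin n → Fin n → ℝ := fun i j =>
    ε i j * (spin (x i) * spin (x j)) - ε i j * (spin (y i) * spin (y j)) with hf
  have hdiff : energy ε x - energy ε y = ∑ e : Edge n, f e.1.1 e.1.2 := by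
    rw [energy, energy, ← Finset.sum_sub_distrib]
  have hfs : ∀ i j, f i j = f j i := fun i j => by
    simp only [hf, hsymm i j, mul_comm (spin (x i)), mul_comm (spin (y i))]
  have hfv : ∀ k, k ≠ v → f v k = 2 * ε v k * (spin (x v) * spin (x k)) := fun k hk => by
    simp only [hf, hyv, hyk k hk]
    ring
  have hf0 : ∀ i j, i ≠ v → j ≠ v → f i j = 0 := fun i j hi hj => by
    simp [hf, hyk i hi, hyk j hj]
  have hS : ∑ k ∈ Finset.univ.erase v, 2 * ε v k * (spin (x v) * spin (x k))
      = ∑ k ∈ Finset.univ.erase v, f v k :=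
    Finset.sum_congr rfl fun k hk => (hfv k (Finset.ne_of_mem_erase hk)).symm
  have h2 := sum_edge_eq_half_sum f hfs
  rw [← Finset.add_sum_erase _ _ (Finset.mem_univ v),
    ← Finset.add_sum_erase Finset.univ _ (Finset.mem_univ v)] at h2
  have h3 : ∑ k ∈ Finset.univ.erase v, (if v = k then 0 else f v k)
      = ∑ k ∈ Finset.univ.erase v, f v k :=
    Finset.sum_congr rfl fun k hk => if_neg (Finset.ne_of_mem_erase hk).symm
  have h4 : ∑ i ∈ Finset.univ.erase v, ∑ j, (if i = j then 0 else f i j)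
      = ∑ k ∈ Finset.univ.erase v, f v k := by
    refine Finset.sum_congr rfl fun i hi => ?_
    have hiv := Finset.ne_of_mem_erase hi
    rw [Finset.sum_eq_single v]
    · rw [if_neg hiv, hfs]
    · intro j _ hj
      rw [hf0 i j hiv hj, ite_self]
    · simp
  rw [h3, h4, if_pos rfl] at h2
  rw [hdiff, hS]
  linarith

/-- The Heisenberg picture: the expectation value of `N* O N` for a matrix `N` applied to the
state. -/
theorem star_mulVec_dotProduct_mulVec {m : Type*} [Fintype m] (N O : Matrix m m ℂ) (w : m → ℂ) :
    star (N *ᵥ w) ⬝ᵥ (O *ᵥ (N *ᵥ w)) = ∑ x, ∑ y, star (w x) * (Nᴴ * O * N) x y * w y := by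
  rw [Matrix.star_mulVec, ← Matrix.dotProduct_mulVec, Matrix.mulVec_mulVec, Matrix.mulVec_mulVec]
  simp only [dotProduct, Matrix.mulVec, Finset.mul_sum, Pi.star_apply, mul_assoc]

/-- Once the bit at `v` is fixed to `b`, each factor depends on its own bit only, and the sum
factors. -/
theorem sum_bits_prod_eq {n : ℕ} (v : Fin n) (g : Fin 2 → Fin n → Fin 2 → ℂ) :
    ∑ x : Bits n, ∏ k, g (x v) k (x k)
      = ∑ b, ∏ k, if k = v then g b v b else ∑ a, g b k a := by
  have h1 : ∀ x : Bits n, ∏ k, g (x v) k (x k)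
      = ∑ b, ∏ k, if k = v then (if x k = b then g b k (x k) else 0) else g b k (x k) := by
    intro x
    rw [Finset.sum_eq_single (x v)]
    · refine Finset.prod_congr rfl fun k _ => ?_
      rcases eq_or_ne k v with rfl | hk
      · simp
      · simp [hk]
    · intro b _ hb
      exact Finset.prod_eq_zero (Finset.mem_univ v) (by simp [hb.symm])
    · simp
  simp_rw [h1]
  rw [Finset.sum_comm]
  refine Finset.sum_congr rfl fun b _ => ?_
  have h2 := Finset.prod_univ_sum (fun _ : Fin n => (Finset.univ : Finset (Fin 2)))
    (fun k a => if k = v then (if a = b then g b k a else 0) else g b k a)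
  rw [Fintype.piFinset_univ] at h2
  rw [← h2]
  refine Finset.prod_congr rfl fun k _ => ?_
  rcases eq_or_ne k v with rfl | hk
  · simp
  · simp [hk]

/-- Qubit `u` is not rotated, `v` makes a quarter turn, and on every other qubit the rotation
cancels by unitarity. -/
theorem conjTranspose_nodeLayer_mul_Zop_mul {n : ℕ} {visited : Finset (Fin n)} {u v : Fin n}
    (hu : u ∈ visited) (hv : v ∉ visited) :
    (nodeLayer (annotation visited) (1 / 2))ᴴ * (Zop u * Zop v)
        * nodeLayer (annotation visited) (1 / 2)
      = tensor fun l => if l = v then !![0, -Complex.I; Complex.I, 0]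
          else if l = u then pauliZ else 1 := by
  have huv : u ≠ v := fun h => hv (h ▸ hu)
  rw [Zop_mul_Zop huv, nodeLayer, conjTranspose_tensor, tensor_mul_tensor, tensor_mul_tensor]
  congr 1
  ext1 l
  rcases eq_or_ne l v with rfl | hlv
  · simp only [annotation, hv, if_false, or_true, if_true]
    exact conjTranspose_Rx_mul_pauliZ_mul_Rx_pi_div_two
  · rcases eq_or_ne l u with rfl | hlu
    · simp [annotation, hu, hlv, Rx_zero]
    · simp [hlv, hlu, conjTranspose_Rx_mul_self]

theorem qValue_eq {n : ℕ} {ε : Fin n → Fin n → ℝ} (hsymm : ∀ i j, ε i j = ε j i) (γ : ℝ)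
    {visited : Finset (Fin n)} {u v : Fin n} (hu : u ∈ visited) (hv : v ∉ visited) :
    qValue ε (1 / 2) γ visited u v
      = ε u v * (Real.sin (2 * ε u v * γ)
        * ∏ k ∈ (Finset.univ.erase v).erase u, Real.cos (2 * ε v k * γ)) := by
  have huv : u ≠ v := fun h => hv (h ▸ hu)
  set w : Bits n → ℂ := edgeLayer ε γ *ᵥ uniformState n with hw
  set B : Fin n → Matrix (Fin 2) (Fin 2) ℂ := fun l =>
    if l = v then !![0, -Complex.I; Complex.I, 0] else if l = u then pauliZ else 1 with hB
  have hnorm : ((1 / Real.sqrt (2 ^ n) : ℝ) : ℂ) * ((1 / Real.sqrt (2 ^ n) : ℝ) : ℂ)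
      = ∏ _k : Fin n, (1 / 2 : ℂ) := by
    rw [← Complex.ofReal_mul, div_mul_div_comm, Real.mul_self_sqrt (by positivity)]
    simp
  -- The share of qubit `k`, with bit `a`, when qubit `v` has bit `b`; the normalisation `2 ^ (-n)`
  -- is spread as one factor `1 / 2` per qubit.
  set g : Fin 2 → Fin n → Fin 2 → ℂ := fun b k a => 1 / 2 *
    if k = v then -(Complex.I * spin b) else
      (if k = u then (spin a : ℂ) else 1)
        * Complex.exp (((2 * ε v k * γ * (spin b * spin a) : ℝ) : ℂ) * Complex.I) with hg
  have hterm : ∀ x : Bits n, ∑ y, star (w x) * tensor B x y * w y = ∏ k, g (x v) k (x k) := by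
    intro x
    -- `Y` has zero diagonal and the other tensor factors are diagonal, so only the flip of `x` at
    -- `v` contributes.
    rw [Finset.sum_eq_single (Function.update x v (1 - x v))]
    · have hTB : tensor B x (Function.update x v (1 - x v))
          = ∏ k, if k = v then -(Complex.I * spin (x v)) else
              if k = u then (spin (x k) : ℂ) else 1 := by
        simp only [tensor, Matrix.of_apply]
        refine Finset.prod_congr rfl fun k _ => ?_
        rcases eq_or_ne k v with rfl | hkv
        · simp only [hB, if_true, Function.update_self]
          generalize x k = a
          fin_cases a <;> simp [spin]
        · rcases eq_or_ne k u with rfl | hku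
          · simp [hB, hkv, pauliZ_eq_diagonal]
          · simp [hB, hkv, hku]
      have hphase : ∀ y, star (w x) * w y = (∏ _k : Fin n, (1 / 2 : ℂ)) *
          Complex.exp (((γ * (energy ε x - energy ε y) : ℝ) : ℂ) * Complex.I) := by
        intro y
        rw [hw, edgeLayer_mulVec_uniformState, edgeLayer_mulVec_uniformState, ← hnorm, star_mul',
          Complex.star_def, ← Complex.exp_conj, map_mul, Complex.conj_ofReal,
          Complex.conj_ofReal, Complex.conj_I, mul_mul_mul_comm, ← Complex.exp_add, mul_comm]
        congr 2
        push_cast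
        ring
      rw [mul_right_comm, hphase, hTB, energy_sub_energy_flip hsymm, Finset.mul_sum,
        Complex.ofReal_sum, Finset.sum_mul, Complex.exp_sum,
        ← Finset.mul_prod_erase _ _ (Finset.mem_univ v),
        ← Finset.mul_prod_erase _ (fun k => g (x v) k (x k)) (Finset.mem_univ v),
        ← Finset.mul_prod_erase Finset.univ (fun k => if k = v then _ else _) (Finset.mem_univ v)]
      have hrest : ∏ k ∈ Finset.univ.erase v, g (x v) k (x k)
          = (∏ k ∈ Finset.univ.erase v, (1 / 2 : ℂ)) *
            (∏ k ∈ Finset.univ.erase v, if k = v then -(Complex.I * spin (x v)) else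
              if k = u then (spin (x k) : ℂ) else 1) *
            ∏ k ∈ Finset.univ.erase v, Complex.exp
              (((γ * (2 * ε v k * (spin (x v) * spin (x k))) : ℝ) : ℂ) * Complex.I) := by
        rw [← Finset.prod_mul_distrib, ← Finset.prod_mul_distrib]
        refine Finset.prod_congr rfl fun k hk => ?_
        simp only [hg, if_neg (Finset.ne_of_mem_erase hk)]
        rw [← mul_assoc]
        congr 4
        ring
      rw [hrest]
      simp only [hg, if_true]
      ring
    · intro y _ hy
      have hT : tensor B x y = 0 := by
        by_cases h : ∃ k, k ≠ v ∧ x k ≠ y k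
        · obtain ⟨k, hkv, hk⟩ := h
          refine Finset.prod_eq_zero (Finset.mem_univ k) ?_
          rcases eq_or_ne k u with rfl | hku
          · simp [hB, hkv, pauliZ_eq_diagonal, hk]
          · simp [hB, hkv, hku, hk]
        · push Not at h
          have hxy : y v = x v := by
            by_contra hne
            apply hy
            ext1 k
            rcases eq_or_ne k v with rfl | hkv
            · rw [Function.update_self]
              generalize x k = a at hne ⊢
              generalize y k = b at hne ⊢
              revert a b
              decide
            · rw [Function.update_of_ne hkv, h k hkv]
          refine Finset.prod_eq_zero (Finset.mem_univ v) ?_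
          rw [hxy]
          generalize x v = a
          fin_cases a <;> simp [hB]
      rw [hT, mul_zero, zero_mul]
    · simp
  have hcos : ∀ b : Fin 2, ∀ k, k ≠ v → k ≠ u →
      ∑ a, g b k a = (Real.cos (2 * ε v k * γ) : ℂ) := by
    intro b k hkv hku
    simp only [hg, if_neg hkv, if_neg hku, Fin.sum_univ_two, spin_zero, spin_one,
      Complex.exp_mul_I]
    generalize 2 * ε v k * γ = θ
    fin_cases b <;> simp [spin] <;> ring
  -- The weight `spin a` coming from `Z_u` turns the half-sum of the two phases into a
  -- half-difference, hence a sine.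
  have hsin : ∀ b : Fin 2, ∑ a, g b u a = Complex.I * spin b * (Real.sin (2 * ε u v * γ) : ℂ) := by
    intro b
    simp only [hg, if_neg huv, if_true, Fin.sum_univ_two, spin_zero, spin_one,
      Complex.exp_mul_I, hsymm v u]
    generalize 2 * ε u v * γ = θ
    fin_cases b <;> simp [spin] <;> ring
  have hprod : ∀ b : Fin 2, (∏ k, if k = v then g b v b else ∑ a, g b k a)
      = 1 / 2 * ((Real.sin (2 * ε u v * γ)
        * ∏ k ∈ (Finset.univ.erase v).erase u, Real.cos (2 * ε v k * γ) : ℝ) : ℂ) := by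
    intro b
    rw [← Finset.mul_prod_erase _ _ (Finset.mem_univ v),
      ← Finset.mul_prod_erase (Finset.univ.erase v) _
        (Finset.mem_erase.2 ⟨huv, Finset.mem_univ u⟩), if_pos rfl, if_neg huv, hsin]
    have : ∏ k ∈ (Finset.univ.erase v).erase u, (if k = v then g b v b else ∑ a, g b k a)
        = ∏ k ∈ (Finset.univ.erase v).erase u, (Real.cos (2 * ε v k * γ) : ℂ) := by
      refine Finset.prod_congr rfl fun k hk => ?_
      have hku := Finset.ne_of_mem_erase hk
      have hkv := Finset.ne_of_mem_erase (Finset.mem_of_mem_erase hk)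
      rw [if_neg hkv, hcos b k hkv hku]
    rw [this]
    have hsq : (spin b : ℂ) * spin b = 1 := by fin_cases b <;> simp [spin]
    simp only [hg, if_true]
    push_cast
    linear_combination (-(1 / 2) * (Complex.sin (2 * ε u v * γ)
      * ∏ k ∈ (Finset.univ.erase v).erase u, Complex.cos (2 * ε v k * γ)))
        * (Complex.I ^ 2 * hsq + Complex.I_sq)
  rw [qValue, circuitState, ← hw, observable, Matrix.smul_mulVec, dotProduct_smul,
    star_mulVec_dotProduct_mulVec, conjTranspose_nodeLayer_mul_Zop_mul hu hv,
    Finset.sum_congr rfl fun x _ => hterm x, sum_bits_prod_eq, Finset.sum_congr rfl fun b _ => hprod b,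
    Finset.sum_const, Finset.card_univ, Fintype.card_fin, smul_eq_mul, two_nsmul,
    ← add_mul, add_halves, one_mul, ← Complex.ofReal_mul, Complex.ofReal_re]

end EQC

/-! ### The choice of `γ`. -/

theorem abs_cos_sub_cos_le_norm_exp_sub_one (a b : ℝ) :
    |Real.cos a - Real.cos b| ≤ ‖Complex.exp (((a - b : ℝ) : ℂ) * Complex.I) - 1‖ ∧
      |Real.sin a - Real.sin b| ≤ ‖Complex.exp (((a - b : ℝ) : ℂ) * Complex.I) - 1‖ := by
  have h : ‖Complex.exp (((a - b : ℝ) : ℂ) * Complex.I) - 1‖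
      = ‖Complex.exp ((a : ℂ) * Complex.I) - Complex.exp ((b : ℂ) * Complex.I)‖ := by
    have : Complex.exp ((a : ℂ) * Complex.I) - Complex.exp ((b : ℂ) * Complex.I)
        = Complex.exp ((b : ℂ) * Complex.I)
          * (Complex.exp (((a - b : ℝ) : ℂ) * Complex.I) - 1) := by
      rw [mul_sub, mul_one, ← Complex.exp_add]
      congr 2
      push_cast
      ring
    rw [this, norm_mul, Complex.norm_exp_ofReal_mul_I, one_mul]
  rw [h]
  constructor
  · simpa [Complex.exp_ofReal_mul_I_re] using Complex.abs_re_le_norm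
      (Complex.exp ((a : ℂ) * Complex.I) - Complex.exp ((b : ℂ) * Complex.I))
  · simpa [Complex.exp_ofReal_mul_I_im] using Complex.abs_im_le_norm
      (Complex.exp ((a : ℂ) * Complex.I) - Complex.exp ((b : ℂ) * Complex.I))

/-- The target `±π / 4` is a compromise: the sine must be large, but edges satisfying `P` also enter
the Q-values through their cosines, which must stay away from `0`. -/
theorem LinearIndependent.exists_cos_sin_bounds {ι : Type*} [Fintype ι] {ε : ι → ℝ}
    (h : LinearIndependent ℤ ε) (P : ι → Prop) {η : ℝ} (hη : 0 < η) :
    ∃ γ : ℝ, ∀ e, 1 / 2 ≤ Real.cos (2 * ε e * γ) ∧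
      (P e → |ε e| / 2 ≤ ε e * Real.sin (2 * ε e * γ)) ∧
      (¬ P e → |ε e * Real.sin (2 * ε e * γ)| ≤ η) := by
  classical
  set C : ℝ := 1 + ∑ e, |ε e| with hC
  have hCpos : 0 < C := add_pos_of_pos_of_nonneg one_pos (Finset.sum_nonneg fun _ _ => abs_nonneg _)
  have hle : ∀ e, |ε e| ≤ C := fun e =>
    (Finset.single_le_sum (fun e _ => abs_nonneg (ε e)) (Finset.mem_univ e)).trans (by linarith)
  set φ : ι → ℝ := fun e =>
    if P e then (if 0 ≤ ε e then Real.pi / 4 else -(Real.pi / 4)) else 0 with hφ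
  -- `√2 / 2 ≥ 7 / 10` leaves room for an error `1 / 10` above `1 / 2`; the error `η / C` absorbs
  -- the weight `|ε e| ≤ C`.
  obtain ⟨t, ht⟩ := h.exists_norm_exp_sub_one_lt φ (δ := min (1 / 10) (η / C)) (by positivity)
  have hsqrt : (7 : ℝ) / 5 ≤ Real.sqrt 2 := Real.le_sqrt_of_sq_le (by norm_num)
  refine ⟨t / 2, fun e => ?_⟩
  have harg : 2 * ε e * (t / 2) = ε e * t := by ring
  rw [harg]
  obtain ⟨hc, hs⟩ := abs_cos_sub_cos_le_norm_exp_sub_one (ε e * t) (φ e)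
  have hc := hc.trans ((ht e).le.trans (min_le_left _ _))
  have hs' := hs.trans ((ht e).le.trans (min_le_left _ _))
  have hs := hs.trans ((ht e).le.trans (min_le_right _ _))
  rw [abs_le] at hc hs'
  refine ⟨?_, fun hP => ?_, fun hP => ?_⟩
  · have : 6 / 10 ≤ Real.cos (φ e) := by
      simp only [hφ]
      split_ifs
      · rw [Real.cos_pi_div_four]; linarith
      · rw [Real.cos_neg, Real.cos_pi_div_four]; linarith
      · rw [Real.cos_zero]; norm_num
    linarith
  · simp only [hφ, if_pos hP] at hs'
    split_ifs at hs' with h0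
    · rw [Real.sin_pi_div_four] at hs'
      rw [abs_of_nonneg h0]
      nlinarith
    · push Not at h0
      rw [Real.sin_neg, Real.sin_pi_div_four] at hs'
      rw [abs_of_neg h0]
      nlinarith
  · simp only [hφ, if_neg hP, Real.sin_zero, sub_zero] at hs
    rw [abs_mul]
    calc |ε e| * |Real.sin (ε e * t)| ≤ C * (η / C) :=
          mul_le_mul (hle e) hs (abs_nonneg _) hCpos.le
      _ = η := mul_div_cancel₀ _ hCpos.ne'

namespace EQC

theorem RationallyIndependent.exists_abs_ge {n : ℕ} {ε : Fin n → Fin n → ℝ}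
    (hsymm : ∀ i j, ε i j = ε j i) (hind : RationallyIndependent ε) :
    ∃ m : ℝ, 0 < m ∧ ∀ i j, i ≠ j → m ≤ |ε i j| := by
  have hne : ∀ i j, i ≠ j → 0 < |ε i j| := by
    intro i j hij
    rw [abs_pos]
    rcases hij.lt_or_gt with h | h
    · exact LinearIndependent.ne_zero (⟨(i, j), h⟩ : Edge n) hind
    · rw [hsymm]
      exact LinearIndependent.ne_zero (⟨(j, i), h⟩ : Edge n) hind
  obtain ⟨m, hm, hlt⟩ := Set.Finite.exists_between'
    (s := {(0 : ℝ)}) (t := Set.range fun e : Edge n => |ε e.1.1 e.1.2|)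
    (Set.finite_singleton 0) (Set.finite_range _) (by
      rintro _ rfl _ ⟨e, rfl⟩
      exact hne _ _ e.2.ne)
  refine ⟨m, hm 0 rfl, fun i j hij => ?_⟩
  rcases hij.lt_or_gt with h | h
  · exact (hlt _ ⟨⟨(i, j), h⟩, rfl⟩).le
  · rw [hsymm]
    exact (hlt _ ⟨⟨(j, i), h⟩, rfl⟩).le

/-- For any symmetric relation `P` on the nodes, some `γ` makes all candidates joined to the last
node by a `P`-edge strictly better than all other candidates. -/
theorem exists_qValue_lt_qValue {n : ℕ} {ε : Fin n → Fin n → ℝ}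
    (hsymm : ∀ i j, ε i j = ε j i) (hind : RationallyIndependent ε)
    (P : Fin n → Fin n → Prop) (hP : ∀ i j, P i j → P j i) :
    ∃ γ : ℝ, (∀ i j, i ≠ j → 0 < Real.cos (2 * ε i j * γ)) ∧
      ∀ (visited : Finset (Fin n)) (u v w : Fin n), u ∈ visited → v ∉ visited → w ∉ visited →
        P u v → ¬ P u w → qValue ε (1 / 2) γ visited u w < qValue ε (1 / 2) γ visited u v := by
  obtain ⟨m, hm, hmle⟩ := hind.exists_abs_ge hsymm
  -- A candidate joined by a `P`-edge scores at least `m / 2 * (1 / 2) ^ n`, having at most `n`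
  -- cosines; the others are held to half of that.
  obtain ⟨γ, hγ⟩ := LinearIndependent.exists_cos_sin_bounds hind (fun e => P e.1.1 e.1.2)
    (η := m / 2 * (1 / 2) ^ n / 2) (by positivity)
  have hγ' : ∀ i j, i ≠ j → 1 / 2 ≤ Real.cos (2 * ε i j * γ) ∧
      (P i j → |ε i j| / 2 ≤ ε i j * Real.sin (2 * ε i j * γ)) ∧
      (¬ P i j → |ε i j * Real.sin (2 * ε i j * γ)| ≤ m / 2 * (1 / 2) ^ n / 2) := by
    intro i j hij
    rcases hij.lt_or_gt with h | h
    · exact hγ ⟨(i, j), h⟩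
    · rw [hsymm, show P i j ↔ P j i from ⟨hP _ _, hP _ _⟩]
      exact hγ ⟨(j, i), h⟩
  refine ⟨γ, fun i j hij => lt_of_lt_of_le (by norm_num) (hγ' i j hij).1, ?_⟩
  intro visited u v w hu hv hw hPv hPw
  have huv : u ≠ v := fun h => hv (h ▸ hu)
  have huw : u ≠ w := fun h => hw (h ▸ hu)
  rw [qValue_eq hsymm γ hu hv, qValue_eq hsymm γ hu hw, ← mul_assoc, ← mul_assoc]
  have hcos : ∀ a, ∀ k ∈ (Finset.univ.erase a).erase u, 1 / 2 ≤ Real.cos (2 * ε a k * γ) :=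
    fun a k hk => (hγ' a k (Finset.ne_of_mem_erase (Finset.mem_of_mem_erase hk)).symm).1
  have hlow : (1 / 2 : ℝ) ^ n ≤ ∏ k ∈ (Finset.univ.erase v).erase u, Real.cos (2 * ε v k * γ) := by
    refine le_trans ?_ (Finset.prod_le_prod (fun _ _ => by norm_num) (hcos v))
    rw [Finset.prod_const]
    refine pow_le_pow_of_le_one (by norm_num) (by norm_num) ?_
    exact (Finset.card_le_univ _).trans_eq (Fintype.card_fin n)
  have hnonneg : 0 ≤ ∏ k ∈ (Finset.univ.erase w).erase u, Real.cos (2 * ε w k * γ) :=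
    Finset.prod_nonneg fun k hk => le_trans (by norm_num) (hcos w k hk)
  have hone : ∏ k ∈ (Finset.univ.erase w).erase u, Real.cos (2 * ε w k * γ) ≤ 1 :=
    Finset.prod_le_one (fun k hk => le_trans (by norm_num) (hcos w k hk))
      fun k _ => Real.cos_le_one _
  have h1 := (hγ' u v huv).2.1 hPv
  have h2 := (le_abs_self _).trans ((hγ' u w huw).2.2 hPw)
  have h3 := hmle u v huv
  have hpos : 0 < m / 2 * (1 / 2 : ℝ) ^ n := by positivity
  calc _ ≤ m / 2 * (1 / 2) ^ n / 2 * ∏ k ∈ (Finset.univ.erase w).erase u,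
          Real.cos (2 * ε w k * γ) := mul_le_mul_of_nonneg_right h2 hnonneg
    _ ≤ m / 2 * (1 / 2) ^ n / 2 := mul_le_of_le_one_right (by positivity) hone
    _ < m / 2 * (1 / 2) ^ n := half_lt_self hpos
    _ ≤ _ := mul_le_mul (by linarith) hlow (by positivity) (by linarith)

theorem apply_mem_visitedBefore {n : ℕ} (T : Tour n) (r t : Fin n) :
    T r ∈ visitedBefore T t ↔ r < t := by
  simp [visitedBefore]

theorem visitedBefore_congr {n : ℕ} {T T' : Tour n} {t : Fin n} (h : ∀ r < t, T' r = T r) :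
    visitedBefore T' t = visitedBefore T t :=
  Finset.image_congr fun r hr => h r (by simpa using hr)

end EQC

/-! ### The node-selection process follows the tour. -/

theorem mainTheorem4 (n : ℕ) [NeZero n] (ε : Fin n → Fin n → ℝ)
    (hsymm : ∀ i j, ε i j = ε j i) (hind : EQC.RationallyIndependent ε)
    (v₀ : Fin n) (T : EQC.Tour n) (hstart : T 0 = v₀) (hopt : EQC.IsOptimalTour ε T) :
    ∃ β γ : ℝ,
      (∀ i j : Fin n, i ≠ j → ∀ m : ℤ, ε i j * γ ≠ Real.pi / 4 + m * Real.pi) ∧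
      ∀ T' : EQC.Tour n, EQC.Produces ε β γ v₀ T' ↔ T' = T := by
  obtain ⟨γ, hcos, hlt⟩ := EQC.exists_qValue_lt_qValue hsymm hind
    -- The closing edge is left out: with it, the last node of `T` would compete with the second one
    -- at the very first step.
    (fun i j => ∃ s t : Fin n, (s : ℕ) + 1 = t ∧ (T s = i ∧ T t = j ∨ T s = j ∧ T t = i))
    (fun i j ⟨s, t, hst, h⟩ => ⟨s, t, hst, h.symm⟩)
  have hbest : ∀ s t : Fin n, (s : ℕ) + 1 = t → ∀ w ∉ EQC.visitedBefore T t, w ≠ T t →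
      EQC.qValue ε (1 / 2) γ (EQC.visitedBefore T t) (T s) w
        < EQC.qValue ε (1 / 2) γ (EQC.visitedBefore T t) (T s) (T t) := by
    intro s t hst w hw hwt
    refine hlt _ _ _ _ ((EQC.apply_mem_visitedBefore T s t).2 (by omega))
      (by simp [EQC.apply_mem_visitedBefore]) hw ⟨s, t, hst, Or.inl ⟨rfl, rfl⟩⟩ ?_
    -- The path neighbours of `T s` are its predecessor, already visited, and `T t`.
    obtain ⟨r, rfl⟩ := T.surjective w
    rw [EQC.apply_mem_visitedBefore] at hw
    have hrt : r ≠ t := fun h => hwt (h ▸ rfl)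
    rintro ⟨a, b, hab, ⟨h1, h2⟩ | ⟨h1, h2⟩⟩ <;> rw [T.injective.eq_iff] at h1 h2 <;> subst h1 h2 <;>
      omega
  refine ⟨1 / 2, γ, fun i j hij m hm => ?_, fun T' => ⟨fun hT' => ?_, ?_⟩⟩
  · have h0 : Real.cos (2 * ε i j * γ) = 0 := by
      rw [Real.cos_eq_zero_iff]
      exact ⟨2 * m, by push_cast; linear_combination 2 * hm⟩
    exact (hcos i j hij).ne' h0
  · have hagree : ∀ k : ℕ, ∀ t : Fin n, (t : ℕ) = k → T' t = T t := by
      intro k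
      induction k using Nat.strong_induction_on with
      | _ k ih =>
        intro t htk
        have hbelow : ∀ r < t, T' r = T r := fun r hr => ih r (by omega) r rfl
        by_contra hne
        have hmem : T' t ∉ EQC.visitedBefore T t := by
          rw [← EQC.visitedBefore_congr hbelow, EQC.apply_mem_visitedBefore]
          exact lt_irrefl t
        rcases Nat.eq_zero_or_pos (t : ℕ) with h0 | hpos
        · have : t = 0 := Fin.ext (by simpa using h0)
          subst this
          exact hne (hT'.1.trans hstart.symm)
        · rcases Nat.lt_or_ge ((t : ℕ) + 1) n with hlast | hlast
          · have hs : (t : ℕ) - 1 < n := by omega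
            set s : Fin n := ⟨t - 1, hs⟩ with hsdef
            have hst : (s : ℕ) + 1 = t := by simp only [hsdef]; omega
            have hnext := hT'.2 s t hst hlast
            rw [EQC.visitedBefore_congr hbelow, hbelow s (by omega)] at hnext
            exact absurd (hnext.2 (T t) (by simp [EQC.apply_mem_visitedBefore]))
              (not_le.2 (hbest s t hst _ hmem hne))
          -- At the last position no Q-value is consulted: only one node remains.
          · obtain ⟨r, hr⟩ := T.surjective (T' t)
            rw [← hr, EQC.apply_mem_visitedBefore] at hmem
            have : r = t := Fin.ext (by omega)
            exact hne (this ▸ hr.symm)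
    exact Equiv.ext fun t => hagree t t rfl
  · rintro rfl
    refine ⟨hstart, fun s t hst _ => ⟨by simp [EQC.apply_mem_visitedBefore], fun w hw => ?_⟩⟩
    rcases eq_or_ne w (T' t) with rfl | hne
    · exact le_rfl
    · exact (hbest s t hst w hw hne).le
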